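/- Let $M\subseteq B(H)$ be a II$_1$ factor with faithful normal trace $\tau$, $\tau(1)=1$. A *bounded right spectral resolution* (brsr) in $M$ on $I=[\alpha,\beta]$ is a decreasing map $E$ from $I$ to the projections of $M$ that is right-continuous for the strong operator topology and satisfies $E_\beta=0$. It is *diffuse* if $E_\alpha=1$ and $E$ is continuous on $I$ for the strong operator topology. A positive $a\in M$ induces the brsr $E_\lambda=P^a(\lambda,\infty)$, $\lambda\in[0,\|a\|]$, where $P^a$ is the spectral measure of $a$; we say that $a$ has *continuous distribution* if this brsr is diffuse. A brsr $E'$ on $I'=[\alpha',\beta']$ *strongly refines* a brsr $E$ on $I=[\alpha,\beta]$ if there is an increasing (not necessarily strictly), right-continuous function $f:I\to I'$ such that $f(\beta)=\beta'$, $E_\lambda=E'_{f(\lambda)}$ and $f(\lambda)\ge\lambda$ for all $\lambda\in I$, and $f(\lambda)-f(\mu)\ge\lambda-\mu$ for all $\lambda>\mu$ in $I$. **Theorem.** For every positive $a\in M$ there is a positive $a'\in M$ with continuous distribution such that the brsr induced by $a'$ strongly refines the brsr induced by $a$. Moreover, if $a\in A$, where $A$ is a masa (maximal abelian self-adjoint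 subalgebra) of $M$, then $a'$ can be chosen in $A$. -/

import Mathlib

open scoped ComplexOrder InnerProductSpace

noncomputable section

namespace SpectralRefinement

variable {H : Type*} [NormedAddCommGroup H] [InnerProductSpace ℂ H] [CompleteSpace H]

/-! ### II₁ factors and masas -/

/-- `M` has trivial centre. -/
def IsFactor (M : VonNeumannAlgebra H) : Prop :=
  ∀ z ∈ M, (∀ y ∈ M, z * y = y * z) → ∃ c : ℂ, z = c • (1 : H →L[ℂ] H)

/-- `p` is a minimal projection of `M`: a nonzero projection of `M` whose only subprojections
in `M` are `0` and `p`. -/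
def IsMinimalProjection (M : VonNeumannAlgebra H) (p : H →L[ℂ] H) : Prop :=
  p ∈ M ∧ IsStarProjection p ∧ p ≠ 0 ∧
    ∀ q ∈ M, IsStarProjection q → q ≤ p → q = 0 ∨ q = p

/-- `τ` is a faithful normal tracial state on `M`. Normality is preservation of suprema of
increasing nets (upward directed sets) of positive elements, in the operator order. -/
structure IsFaithfulNormalTrace (M : VonNeumannAlgebra H)
    (τ : M.toStarSubalgebra →ₗ[ℂ] ℂ) : Prop where
  map_one : τ 1 = 1
  nonneg : ∀ x, 0 ≤ τ (star x * x)
  tracial : ∀ x y, τ (x * y) = τ (y * x)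
  faithful : ∀ x, τ (star x * x) = 0 → x = 0
  normal : ∀ (S : Set M.toStarSubalgebra) (s : M.toStarSubalgebra), S.Nonempty →
    (∀ x ∈ S, (0 : H →L[ℂ] H) ≤ x) → DirectedOn (· ≤ ·) S → IsLUB S s →
    IsLUB ((fun x => (τ x).re) '' S) (τ s).re

/-- `(M, τ)` is a II₁ factor: a factor with a faithful normal trace `τ` such that `τ 1 = 1`
(so `M` is finite and nonzero), and without minimal projections (so `M` is not of type I). -/
structure IsIIOneFactor (M : VonNeumannAlgebra H)
    (τ : M.toStarSubalgebra →ₗ[ℂ] ℂ) : Prop where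
  factor : IsFactor M
  trace : IsFaithfulNormalTrace M τ
  no_minimal : ∀ p, ¬ IsMinimalProjection M p

/-- `A` is a masa in `M`: a maximal element among the abelian self-adjoint subalgebras of `M`. -/
def IsMasa (M : VonNeumannAlgebra H) (A : StarSubalgebra ℂ (H →L[ℂ] H)) : Prop :=
  Maximal (fun B : StarSubalgebra ℂ (H →L[ℂ] H) =>
    B ≤ M.toStarSubalgebra ∧ ∀ x ∈ B, ∀ y ∈ B, x * y = y * x) A

/-! ### Spectral projections of half-lines -/

/-- The orthogonal projection onto the closure of the range of `T`. -/
def rangeProj (T : H →L[ℂ] H) : H →L[ℂ] H :=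
  (T.range.topologicalClosure).starProjection

/-- The spectral projection of the self-adjoint operator `a` for the half-line `(l, ∞)`:
the projection onto the closure of the range of the positive part of `a - l`.
See `measure_Ioi_eq` for the link with the spectral measures of `a`. -/
def spectralProjIoi (a : H →L[ℂ] H) (l : ℝ) : H →L[ℂ] H :=
  rangeProj (cfc (fun t : ℝ => max (t - l) 0) a)

/-- If `μ` is the scalar spectral measure of the self-adjoint operator `a` at the vector `x`,
i.e. `∫ f dμ = ⟪x, f(a) x⟫` for all bounded continuous `f`, then
`μ (l, ∞) = ⟪x, P x⟫` with `P = spectralProjIoi a l`. -/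
theorem measure_Ioi_eq (a : H →L[ℂ] H) (_ha : IsSelfAdjoint a) (l : ℝ) (x : H)
    (μ : MeasureTheory.Measure ℝ) [MeasureTheory.IsFiniteMeasure μ]
    (hμ : ∀ f : ℝ → ℝ, Continuous f → (∃ C, ∀ t, |f t| ≤ C) →
      ((∫ t, f t ∂μ : ℝ) : ℂ) = ⟪x, cfc f a x⟫_ℂ) :
    ((μ.real (Set.Ioi l) : ℝ) : ℂ) = ⟪x, spectralProjIoi a l x⟫_ℂ := by
  set g : ℝ → ℝ := fun t => max (t - l) 0 with hg
  have hg0 : ∀ t, 0 ≤ g t := fun t => le_max_right _ _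
  have hgc : Continuous g := by fun_prop
  have hpos : ∀ (n : ℕ) t, 0 < 1 + (n + 1) * g t := fun n t => by have := hg0 t; positivity
  -- the bounded continuous functions `(n + 1) g / (1 + (n + 1) g)` increase to the indicator of `(l, ∞)`
  let k : ℕ → ℝ → ℝ := fun n t => (n + 1) / (1 + (n + 1) * g t)
  let φ : ℕ → ℝ → ℝ := fun n t => k n t * g t
  have hkc : ∀ n, Continuous (k n) := fun n =>
    continuous_const.div (by fun_prop) (fun t => (hpos n t).ne')
  have hφc : ∀ n, Continuous (φ n) := fun n => (hkc n).mul hgc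
  have hφ0 : ∀ n t, 0 ≤ φ n t := fun n t =>
    mul_nonneg (div_nonneg (by positivity) (hpos n t).le) (hg0 t)
  have hφeq : ∀ n t, φ n t = (n + 1) * g t / (1 + (n + 1) * g t) := fun n t => by simp only [φ, k]; ring
  have hφ1 : ∀ n t, φ n t ≤ 1 := fun n t => by
    rw [hφeq, div_le_one (hpos n t)]; linarith
  have hφa : ∀ n t, |φ n t| ≤ 1 := fun n t => by rw [abs_of_nonneg (hφ0 n t)]; exact hφ1 n t
  have hTn : ∀ n, ‖cfc (φ n) a‖ ≤ 1 := fun n =>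
    norm_cfc_le zero_le_one (fun t _ => by simpa using hφa n t)
  -- strong convergence of `φ n (a)` to the range projection
  set P := spectralProjIoi a l with hP
  have hker : ∀ y, cfc g a y = 0 → ∀ n, cfc (φ n) a y = 0 := fun y hy n => by
    have : cfc (φ n) a = cfc (k n) a * cfc g a :=
      cfc_mul (k n) g a (hkc n).continuousOn hgc.continuousOn
    rw [this]; change cfc (k n) a (cfc g a y) = 0; rw [hy, map_zero]
  have hrange : ∀ y, Filter.Tendsto (fun n => cfc (φ n) a (cfc g a y)) Filter.atTop
      (nhds (cfc g a y)) := fun y => by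
    rw [tendsto_iff_norm_sub_tendsto_zero]
    have hb : ∀ n : ℕ, ‖cfc (φ n) a (cfc g a y) - cfc g a y‖ ≤ 1 / ((n : ℝ) + 1) * ‖y‖ := by
      intro n
      have h1 : cfc (fun t => (fun r => φ n r * g r) t - g t) a =
          cfc (φ n) a * cfc g a - cfc g a := by
        rw [cfc_sub (fun r => φ n r * g r) g a ((hφc n).mul hgc).continuousOn hgc.continuousOn,
          cfc_mul (φ n) g a (hφc n).continuousOn hgc.continuousOn]
      have h2 : ‖cfc (fun t => (fun r => φ n r * g r) t - g t) a‖ ≤ 1 / ((n : ℝ) + 1) := by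
        refine norm_cfc_le (by positivity) (fun t _ => ?_)
        have hp := hpos n t
        have e : φ n t * g t - g t = -(g t / (1 + (n + 1) * g t)) := by
          rw [hφeq]; field_simp; ring
        change ‖φ n t * g t - g t‖ ≤ _
        rw [e, norm_neg, Real.norm_of_nonneg (div_nonneg (hg0 t) hp.le),
          div_le_div_iff₀ hp (by positivity)]
        linarith
      rw [h1] at h2
      exact (ContinuousLinearMap.le_opNorm (cfc (φ n) a * cfc g a - cfc g a) y).trans
        (mul_le_mul_of_nonneg_right h2 (norm_nonneg y))
    refine squeeze_zero (fun _ => norm_nonneg _) hb ?_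
    simpa using tendsto_one_div_add_atTop_nhds_zero_nat.mul_const ‖y‖
  have hmem : ∀ z ∈ ((cfc g a).range).topologicalClosure,
      Filter.Tendsto (fun n => cfc (φ n) a z) Filter.atTop (nhds z) := by
    intro z hz
    rw [Metric.tendsto_atTop]
    intro ε hε
    have hz' : z ∈ closure (((cfc g a).range : Submodule ℂ H) : Set H) := hz
    obtain ⟨_, ⟨y, rfl⟩, hw⟩ := Metric.mem_closure_iff.1 hz' (ε / 3) (by positivity)
    obtain ⟨N, hN⟩ := Metric.tendsto_atTop.1 (hrange y) (ε / 3) (by positivity)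
    refine ⟨N, fun n hn => ?_⟩
    have h1 : dist (cfc (φ n) a z) (cfc (φ n) a (cfc g a y)) ≤ dist z (cfc g a y) := by
      rw [dist_eq_norm, ← map_sub, dist_eq_norm]
      simpa using ContinuousLinearMap.le_of_opNorm_le _ (hTn n) (z - cfc g a y)
    have h2 := hN n hn
    have h3 : dist z (cfc g a y) < ε / 3 := hw
    have h4 := dist_triangle4 (cfc (φ n) a z) (cfc (φ n) a (cfc g a y)) (cfc g a y) z
    rw [dist_comm (cfc g a y) z] at h4
    linarith
  have hconv : Filter.Tendsto (fun n => cfc (φ n) a x) Filter.atTop (nhds (P x)) := by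
    have hPx : P x ∈ ((cfc g a).range).topologicalClosure :=
      Submodule.starProjection_apply_mem _ x
    have hx : cfc g a (x - P x) = 0 := by
      have hortho : x - P x ∈ ((cfc g a).range).topologicalClosureᗮ :=
        Submodule.sub_starProjection_mem_orthogonal x
      have hsa : IsSelfAdjoint (cfc g a) := cfc_predicate g a
      rw [Submodule.orthogonal_closure, ContinuousLinearMap.orthogonal_range,
        hsa.adjoint_eq] at hortho
      exact hortho
    have h := hmem (P x) hPx
    refine h.congr fun n => ?_
    have := hker _ hx n
    rw [map_sub, sub_eq_zero] at this
    exact this.symm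
  have hlim1 : Filter.Tendsto (fun n => ((∫ t, φ n t ∂μ : ℝ) : ℂ)) Filter.atTop
      (nhds ⟪x, P x⟫_ℂ) := by
    simp_rw [fun n => hμ (φ n) (hφc n) ⟨1, hφa n⟩]
    exact tendsto_const_nhds.inner hconv
  have hlim2 : Filter.Tendsto (fun n => ∫ t, φ n t ∂μ) Filter.atTop
      (nhds (∫ t, (Set.Ioi l).indicator (fun _ => (1 : ℝ)) t ∂μ)) := by
    refine MeasureTheory.tendsto_integral_of_dominated_convergence (fun _ => 1)
      (fun n => (hφc n).aestronglyMeasurable) (MeasureTheory.integrable_const _)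
      (fun n => Filter.Eventually.of_forall fun t => by simpa using hφa n t)
      (Filter.Eventually.of_forall fun t => ?_)
    by_cases ht : t ∈ Set.Ioi l
    · have hgt : 0 < g t := lt_max_of_lt_left (sub_pos.2 ht)
      have e : ∀ n, φ n t = 1 - 1 / (1 + (n + 1) * g t) := fun n => by
        rw [hφeq]; have := hpos n t; field_simp; ring
      rw [Set.indicator_of_mem ht]
      simp_rw [e]
      have : Filter.Tendsto (fun n : ℕ => 1 + ((n : ℝ) + 1) * g t) Filter.atTop Filter.atTop :=
        Filter.tendsto_atTop_add_const_left _ _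
          ((Filter.tendsto_atTop_add_const_right _ _ tendsto_natCast_atTop_atTop).atTop_mul_const
            hgt)
      simpa using (tendsto_const_nhds (x := (1 : ℝ))).sub (this.const_div_atTop 1)
    · have hgt : g t = 0 := max_eq_right (sub_nonpos.2 (not_lt.1 ht))
      rw [Set.indicator_of_notMem ht]
      simp [φ, hgt]
  rw [MeasureTheory.integral_indicator_const _ measurableSet_Ioi] at hlim2
  have := tendsto_nhds_unique ((Complex.continuous_ofReal.tendsto _).comp hlim2) hlim1
  simpa using this

/-! ### Bounded right spectral resolutions -/

/-- Continuity at `t`, relative to `s`, of a family of operators for the strong operator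
topology. -/
def SOTContinuousWithinAt (E : ℝ → H →L[ℂ] H) (s : Set ℝ) (t : ℝ) : Prop :=
  ∀ x : H, ContinuousWithinAt (fun r => E r x) s t

/-- The restriction of `E` to `[α, β]` is a bounded right spectral resolution (brsr) in `M`
of the projection `E α`. Values of `E` outside `[α, β]` play no role. -/
structure IsBRSR (M : VonNeumannAlgebra H) (α β : ℝ) (E : ℝ → H →L[ℂ] H) : Prop where
  le : α ≤ β
  mem : ∀ t ∈ Set.Icc α β, E t ∈ M
  proj : ∀ t ∈ Set.Icc α β, IsStarProjection (E t)
  anti : AntitoneOn E (Set.Icc α β)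
  right_cont : ∀ t ∈ Set.Icc α β, SOTContinuousWithinAt E (Set.Icc t β) t
  right_end : E β = 0

/-- The atoms of a brsr on `[α, β]`: the points of `(α, β]` where it is not continuous,
together with `α` if `E α ≠ 1`. -/
def atoms (α β : ℝ) (E : ℝ → H →L[ℂ] H) : Set ℝ :=
  {t | t ∈ Set.Ioc α β ∧ ¬ SOTContinuousWithinAt E (Set.Icc α β) t} ∪ {t | t = α ∧ E α ≠ 1}

/-- `E` is a diffuse brsr on `[α, β]`. -/
def IsDiffuseBRSR (M : VonNeumannAlgebra H) (α β : ℝ) (E : ℝ → H →L[ℂ] H) : Prop :=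
  IsBRSR M α β E ∧ atoms α β E = ∅

/-- `(E', f)` is a refinement of `E`, for brsr's `E` on `[α, β]` and `E'` on `[α', β']`. -/
structure IsRefinement (M : VonNeumannAlgebra H) (α' β' : ℝ) (E' : ℝ → H →L[ℂ] H)
    (α β : ℝ) (E : ℝ → H →L[ℂ] H) (f : ℝ → ℝ) : Prop where
  brsr : IsBRSR M α β E
  brsr' : IsBRSR M α' β' E'
  mapsTo : Set.MapsTo f (Set.Icc α β) (Set.Icc α' β')
  mono : MonotoneOn f (Set.Icc α β)
  right_cont : ∀ t ∈ Set.Icc α β, ContinuousWithinAt f (Set.Icc t β) t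
  right_end : f β = β'
  comp : ∀ t ∈ Set.Icc α β, E t = E' (f t)

/-- The brsr `E'` on `[α', β']` strongly refines the brsr `E` on `[α, β]`. -/
def StronglyRefines (M : VonNeumannAlgebra H) (α' β' : ℝ) (E' : ℝ → H →L[ℂ] H)
    (α β : ℝ) (E : ℝ → H →L[ℂ] H) : Prop :=
  ∃ f : ℝ → ℝ, IsRefinement M α' β' E' α β E f ∧
    (∀ t ∈ Set.Icc α β, t ≤ f t) ∧
    ∀ s ∈ Set.Icc α β, ∀ t ∈ Set.Icc α β, s < t → t - s ≤ f t - f s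

/-- The positive operator `a` has continuous distribution: the brsr on `[0, ‖a‖]` that it
induces, `t ↦ P^a(t, ∞)`, is diffuse. -/
def HasContinuousDistribution (M : VonNeumannAlgebra H) (a : H →L[ℂ] H) : Prop :=
  IsDiffuseBRSR M 0 ‖a‖ (spectralProjIoi a)

/-- The brsr on `[0, ‖b‖]` induced by the positive operator `b` strongly refines the brsr on
`[0, ‖a‖]` induced by the positive operator `a`. -/
def InducedStronglyRefines (M : VonNeumannAlgebra H) (b a : H →L[ℂ] H) : Prop :=
  StronglyRefines M 0 ‖b‖ (spectralProjIoi b) 0 ‖a‖ (spectralProjIoi a)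

end SpectralRefinement

end

/-!
Write `E l = P^a(l, ∞)` and `d l = τ (E l)`. The idea is to fill in the jumps of `E` without leaving
the given algebra `N`, which is `M` itself or a masa of `M`, and then to stretch the parameter so
that each jump gets room.

* A masa is a von Neumann algebra (`IsMasa.exists_vonNeumannAlgebra`), and a minimal projection of a
  masa is minimal in `M` (`IsMasa.isMinimalProjection`). Hence `N` is a von Neumann algebra without
  minimal projections in both cases, and nothing else is used of it.
* A maximal chain of projections of `N` that contains all `E l` is closed under suprema and infima.
  By normality and faithfulness of `τ`, and because no gap can remain in the absence of minimal
  projections, `τ` maps it bijectively onto `[0, 1]` (`Proj.exists_monotone_dim_eq`). Let `e s` be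
  its element of trace `s`; then `E l = e (d l)`. A monotone family of projections whose trace is
  continuous is continuous for the strong operator topology (`Proj.continuous_apply`).
* The function `f l = l + 1 - d l` increases at least as fast as `l`, and there is a continuous
  decreasing `φ` with `φ (f l) = d l` (`exists_continuous_antitone_reparam`). So `G = e ∘ φ` is a
  diffuse resolution on `[0, ‖a‖ + 1]` with `G (f l) = E l`.
* Finally `a' = ∫ G s ds` over `[0, ‖a‖ + 1]`, a strong integral, is an operator of `N` whose
  spectral resolution is `G`: the integrals of `G` over `[s, ‖a‖ + 1]` and of `1 - G` over `[0, s]`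
  are positive with product `0`, hence are the positive and negative parts of `a' - s`
  (`spectralProjIoi_strongIntegral`).
-/

open scoped ComplexOrder InnerProductSpace

noncomputable section

namespace SpectralRefinement

variable {H : Type*} [NormedAddCommGroup H] [InnerProductSpace ℂ H] [CompleteSpace H]

/-! ### Star projections and range projections -/

theorem isStarProjection_apply_self {p : H →L[ℂ] H} (hp : IsStarProjection p) (x : H) :
    p (p x) = p x :=
  congr($(hp.isIdempotentElem.eq) x)

theorem isStarProjection_le_of_apply_eq_zero {p q : H →L[ℂ] H} (hp : IsStarProjection p)
    (hq : IsStarProjection q) (h : ∀ x, q x = 0 → p x = 0) : p ≤ q := by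
  refine hp.le_of_mul_eq_left hq ?_
  ext x
  have h1 : p (x - q x) = 0 := h _ (by rw [map_sub, isStarProjection_apply_self hq, sub_self])
  rw [map_sub, sub_eq_zero] at h1
  exact h1.symm

theorem isStarProjection_apply_apply_of_le {p q : H →L[ℂ] H} (hp : IsStarProjection p)
    (hq : IsStarProjection q) (h : p ≤ q) (x : H) : q (p x) = p x :=
  congr($((hp.le_iff_mul_eq_right hq).1 h) x)

theorem isStarProjection_apply_apply_of_le' {p q : H →L[ℂ] H} (hp : IsStarProjection p)
    (hq : IsStarProjection q) (h : p ≤ q) (x : H) : p (q x) = p x :=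
  congr($((hp.le_iff_mul_eq_left hq).1 h) x)

theorem isStarProjection_norm_apply_le {p : H →L[ℂ] H} (hp : IsStarProjection p) (x : H) :
    ‖p x‖ ≤ ‖x‖ := by
  simpa using p.le_of_opNorm_le (hp.norm_le p) x

theorem norm_sub_apply_le_of_le_of_le {p p' q : H →L[ℂ] H} (hp : IsStarProjection p)
    (hp' : IsStarProjection p') (hq : IsStarProjection q) (h : p ≤ p') (h' : p' ≤ q) (x : H) :
    ‖q x - p' x‖ ≤ ‖q x - p x‖ := by
  have e : q x - p' x = (1 - p') (q x - p x) := by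
    simp [isStarProjection_apply_apply_of_le hp hp' h,
      isStarProjection_apply_apply_of_le' hp' hq h']
  rw [e]
  exact isStarProjection_norm_apply_le hp'.one_sub _

theorem isStarProjection_rangeProj (T : H →L[ℂ] H) : IsStarProjection (rangeProj T) :=
  isStarProjection_starProjection

theorem rangeProj_apply_apply (T : H →L[ℂ] H) (x : H) : rangeProj T (T x) = T x :=
  Submodule.starProjection_eq_self_iff.2 (Submodule.le_topologicalClosure _ ⟨x, rfl⟩)

theorem rangeProj_apply_eq_zero_iff {T : H →L[ℂ] H} (hT : IsSelfAdjoint T) (x : H) :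
    rangeProj T x = 0 ↔ T x = 0 := by
  rw [rangeProj, Submodule.starProjection_apply_eq_zero_iff, Submodule.orthogonal_closure,
    ContinuousLinearMap.orthogonal_range, hT.adjoint_eq]
  rfl

theorem rangeProj_eq_zero_iff {T : H →L[ℂ] H} (hT : IsSelfAdjoint T) :
    rangeProj T = 0 ↔ T = 0 := by
  simp [ContinuousLinearMap.ext_iff, rangeProj_apply_eq_zero_iff hT]

theorem isStarProjection_eq_of_apply_eq_zero_iff {p q : H →L[ℂ] H} (hp : IsStarProjection p)
    (hq : IsStarProjection q) (h : ∀ x, p x = 0 ↔ q x = 0) : p = q :=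
  le_antisymm (isStarProjection_le_of_apply_eq_zero hp hq fun x => (h x).2)
    (isStarProjection_le_of_apply_eq_zero hq hp fun x => (h x).1)

/-- The projection onto the closure of a subspace invariant under the commutant of `N` is
in `N`. -/
theorem starProjection_topologicalClosure_mem {N : VonNeumannAlgebra H} (K : Submodule ℂ H)
    (h : ∀ y ∈ N.commutant, ∀ z ∈ K, y z ∈ K) : K.topologicalClosure.starProjection ∈ N := by
  rw [VonNeumannAlgebra.IsStarProjection.mem_iff isStarProjection_starProjection]
  intro y hy
  rw [Submodule.range_starProjection, Module.End.mem_invtSubmodule_iff_forall_mem_of_mem]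
  intro z hz
  exact map_mem_closure y.continuous hz (h y hy)

theorem apply_comm_of_mem_commutant {N : VonNeumannAlgebra H} {y T : H →L[ℂ] H}
    (hy : y ∈ N.commutant) (hT : T ∈ N) (x : H) : y (T x) = T (y x) :=
  congr($(VonNeumannAlgebra.mem_commutant_iff.1 hy T hT) x).symm

theorem rangeProj_mem {N : VonNeumannAlgebra H} {T : H →L[ℂ] H} (hT : T ∈ N) :
    rangeProj T ∈ N := by
  refine starProjection_topologicalClosure_mem _ ?_
  rintro y hy _ ⟨x, rfl⟩
  exact ⟨y x, (apply_comm_of_mem_commutant hy hT x).symm⟩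

theorem mem_of_forall_commutant {N : VonNeumannAlgebra H} {T : H →L[ℂ] H}
    (h : ∀ y ∈ N.commutant, ∀ x, y (T x) = T (y x)) : T ∈ N := by
  rw [← VonNeumannAlgebra.commutant_commutant N, VonNeumannAlgebra.mem_commutant_iff]
  intro y hy
  ext x
  exact h y hy x

theorem cfc_mem {N : VonNeumannAlgebra H} {a : H →L[ℂ] H} (ha : IsSelfAdjoint a) (haN : a ∈ N)
    (f : ℝ → ℝ) : cfc f a ∈ N := by
  refine mem_of_forall_commutant fun y hy x => ?_
  have h : Commute a y := VonNeumannAlgebra.mem_commutant_iff.1 hy a haN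
  exact congr($((ha.commute_cfc h f).eq) x).symm

/-! ### Spectral projections of half-lines -/

theorem isStarProjection_spectralProjIoi (a : H →L[ℂ] H) (l : ℝ) :
    IsStarProjection (spectralProjIoi a l) :=
  isStarProjection_rangeProj _

theorem spectralProjIoi_mem {N : VonNeumannAlgebra H} {a : H →L[ℂ] H} (ha : IsSelfAdjoint a)
    (haN : a ∈ N) (l : ℝ) : spectralProjIoi a l ∈ N :=
  rangeProj_mem (cfc_mem ha haN _)

theorem eq_zero_of_inner_self_eq_zero {T : H →L[ℂ] H} (hT : 0 ≤ T) {x : H}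
    (h : ⟪T x, x⟫_ℂ = 0) : T x = 0 := by
  obtain ⟨s, rfl⟩ := CStarAlgebra.nonneg_iff_eq_star_mul_self.1 hT
  rw [ContinuousLinearMap.star_eq_adjoint] at h ⊢
  have h1 : ⟪s x, s x⟫_ℂ = 0 := by
    rw [← ContinuousLinearMap.adjoint_inner_left]; exact h
  have h2 : s x = 0 := inner_self_eq_zero.1 h1
  simp [h2]

theorem apply_eq_zero_of_le {S T : H →L[ℂ] H} (hS : 0 ≤ S) (hST : S ≤ T) {x : H}
    (h : T x = 0) : S x = 0 := by
  refine eq_zero_of_inner_self_eq_zero hS ?_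
  have h1 : 0 ≤ ⟪S x, x⟫_ℂ :=
    ((ContinuousLinearMap.nonneg_iff_isPositive S).1 hS).inner_nonneg_left x
  have h2 : 0 ≤ ⟪(T - S) x, x⟫_ℂ :=
    ((ContinuousLinearMap.le_def S T).1 hST).inner_nonneg_left x
  rw [sub_apply, h, zero_sub, inner_neg_left] at h2
  exact le_antisymm (neg_nonneg.1 h2) h1

theorem antitone_spectralProjIoi (a : H →L[ℂ] H) :
    Antitone (spectralProjIoi a) := by
  intro l m hlm
  refine isStarProjection_le_of_apply_eq_zero (isStarProjection_spectralProjIoi a m)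
    (isStarProjection_spectralProjIoi a l) fun x hx => ?_
  rw [spectralProjIoi, rangeProj_apply_eq_zero_iff (cfc_predicate _ a)] at hx ⊢
  refine apply_eq_zero_of_le (cfc_nonneg fun t _ => le_max_right _ _) ?_ hx
  exact cfc_mono (fun t _ => max_le_max (by linarith) le_rfl)

theorem spectralProjIoi_eq_zero {a : H →L[ℂ] H} {l : ℝ} (hl : ‖a‖ ≤ l) :
    spectralProjIoi a l = 0 := by
  rw [spectralProjIoi, rangeProj_eq_zero_iff (cfc_predicate _ a)]
  refine (cfc_congr fun t ht => ?_).trans (cfc_const_zero ℝ a)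
  have : Nontrivial (H →L[ℂ] H) := by
    by_contra h
    rw [not_nontrivial_iff_subsingleton] at h
    simp [spectrum.of_subsingleton] at ht
  have : Nontrivial H := by
    by_contra h
    rw [not_nontrivial_iff_subsingleton] at h
    exact not_subsingleton (H →L[ℂ] H) inferInstance
  have : ‖t‖ ≤ ‖a‖ := spectrum.norm_le_norm_of_mem ht
  exact max_eq_right (by linarith [le_abs_self t, Real.norm_eq_abs t])

theorem spectralProjIoi_ne_zero [Nontrivial H] {a : H →L[ℂ] H} (ha : 0 ≤ a) {l : ℝ}
    (hl : l < ‖a‖) : spectralProjIoi a l ≠ 0 := by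
  rw [spectralProjIoi, Ne, rangeProj_eq_zero_iff (cfc_predicate _ a)]
  intro h
  have h1 := spectrum.zero_eq (𝕜 := ℝ) (A := H →L[ℂ] H)
  rw [← h, cfc_map_spectrum (fun t : ℝ => max (t - l) 0) a] at h1
  have h2 : max (‖a‖ - l) 0 ∈ ({0} : Set ℝ) :=
    h1 ▸ ⟨‖a‖, CStarAlgebra.norm_mem_spectrum_of_nonneg ha, rfl⟩
  have h3 : max (‖a‖ - l) 0 = 0 := h2
  linarith [max_eq_right_iff.1 h3]

theorem spectralProjIoi_eq_one {a : H →L[ℂ] H} (ha : 0 ≤ a) {l : ℝ} (hl : l < 0) :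
    spectralProjIoi a l = 1 := by
  refine isStarProjection_eq_of_apply_eq_zero_iff (isStarProjection_spectralProjIoi a l) (.one _)
    fun x => ⟨fun hx => ?_, fun hx => by rw [show x = 0 from hx, map_zero]⟩
  rw [spectralProjIoi, rangeProj_apply_eq_zero_iff (cfc_predicate _ a)] at hx
  have hc : ∀ t ∈ spectrum ℝ a, 0 < t - l := fun t ht => by
    linarith [spectrum_nonneg_of_nonneg ha ht]
  have h1 : cfc (fun t : ℝ => (t - l)⁻¹) a * cfc (fun t : ℝ => max (t - l) 0) a = 1 := by
    rw [← cfc_mul (fun t : ℝ => (t - l)⁻¹) _ a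
      (ContinuousOn.inv₀ (by fun_prop) fun t ht => (hc t ht).ne')]
    refine (cfc_congr fun t ht => ?_).trans (cfc_const_one ℝ a)
    have := hc t ht
    simp only [max_eq_left this.le]
    exact inv_mul_cancel₀ this.ne'
  have h2 := congr($h1 x)
  rw [mul_apply_eq_comp, hx, map_zero] at h2
  exact h2.symm

/-- Right continuity of the spectral resolution: `(a - l)₊` is the norm limit of `(a - m)₊` as
`m` decreases to `l`, so the range of `P^a(l, ∞)` is approximated by those of `P^a(m, ∞)`. -/
theorem exists_norm_spectralProjIoi_sub_lt (a : H →L[ℂ] H) (l : ℝ)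
    (x : H) {ε : ℝ} (hε : 0 < ε) :
    ∃ m, l < m ∧ ‖spectralProjIoi a l x - spectralProjIoi a m x‖ < ε := by
  have hx : spectralProjIoi a l x ∈
      ((cfc (fun t : ℝ => max (t - l) 0) a).range).topologicalClosure :=
    Submodule.starProjection_apply_mem _ x
  replace hx : spectralProjIoi a l x ∈
      closure (((cfc (fun t : ℝ => max (t - l) 0) a).range : Submodule ℂ H) : Set H) := hx
  obtain ⟨_, ⟨y, rfl⟩, hy⟩ := Metric.mem_closure_iff.1 hx (ε / 2) (by positivity)
  obtain ⟨δ, hδ, hδy⟩ : ∃ δ > 0, δ * ‖y‖ < ε / 2 := by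
    refine ⟨ε / 2 / (‖y‖ + 1), by positivity, ?_⟩
    rw [div_mul_eq_mul_div, div_lt_iff₀ (by positivity)]
    nlinarith [norm_nonneg y]
  refine ⟨l + δ, by linarith, ?_⟩
  set g : ℝ → H →L[ℂ] H := fun l => cfc (fun t : ℝ => max (t - l) 0) a with hg
  set p := spectralProjIoi a l
  set q := spectralProjIoi a (l + δ)
  have hp : IsStarProjection p := isStarProjection_spectralProjIoi a _
  have hq : IsStarProjection q := isStarProjection_spectralProjIoi a _
  have hqp : q ≤ p := antitone_spectralProjIoi a (by linarith)
  have h1 : ‖g l y - g (l + δ) y‖ ≤ δ * ‖y‖ := by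
    have : ‖g l - g (l + δ)‖ ≤ δ := by
      rw [hg]
      simp only
      rw [← cfc_sub (fun t : ℝ => max (t - l) 0) (fun t : ℝ => max (t - (l + δ)) 0) a]
      refine norm_cfc_le hδ.le fun t _ => ?_
      have := abs_max_sub_max_le_max (t - l) 0 (t - (l + δ)) 0
      refine this.trans (max_le ?_ (by simpa using hδ.le))
      rw [show t - l - (t - (l + δ)) = δ by ring, abs_of_pos hδ]
    exact (g l - g (l + δ)).le_of_opNorm_le this y
  -- the vector `(a - m)₊ y` is fixed by `q`, so `1 - q` only sees the error terms
  have h2 : p x - q x = (1 - q) (p x - g l y + (g l y - g (l + δ) y)) := by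
    have : q (g (l + δ) y) = g (l + δ) y := rangeProj_apply_apply _ _
    simp [this, isStarProjection_apply_apply_of_le' hq hp hqp]
  rw [h2]
  refine (isStarProjection_norm_apply_le hq.one_sub _).trans_lt ((norm_add_le _ _).trans_lt ?_)
  have h3 : ‖p x - g l y‖ < ε / 2 := by rw [← dist_eq_norm]; exact hy
  linarith

theorem isBRSR_spectralProjIoi {M : VonNeumannAlgebra H} {a : H →L[ℂ] H} (ha : IsSelfAdjoint a)
    (haM : a ∈ M) : IsBRSR M 0 ‖a‖ (spectralProjIoi a) where
  le := norm_nonneg a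
  mem t _ := spectralProjIoi_mem ha haM t
  proj t _ := isStarProjection_spectralProjIoi a t
  anti := (antitone_spectralProjIoi a).antitoneOn _
  right_cont t _ x := by
    refine ContinuousWithinAt.mono (t := Set.Ici t) ?_ Set.Icc_subset_Ici_self
    refine Metric.tendsto_nhds.2 fun ε hε => ?_
    obtain ⟨m, hm, hmx⟩ := exists_norm_spectralProjIoi_sub_lt a t x hε
    filter_upwards [self_mem_nhdsWithin, mem_nhdsWithin_of_mem_nhds (Iio_mem_nhds hm)] with s hs hs'
    rw [dist_eq_norm, norm_sub_rev]
    exact (norm_sub_apply_le_of_le_of_le (isStarProjection_spectralProjIoi a _)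
      (isStarProjection_spectralProjIoi a _) (isStarProjection_spectralProjIoi a _)
      (antitone_spectralProjIoi a (le_of_lt hs')) (antitone_spectralProjIoi a hs) x).trans_lt hmx
  right_end := spectralProjIoi_eq_zero le_rfl

/-! ### Integrals of strongly continuous families of projections -/

/-- The strong integral `x ↦ ∫ r in u..v, F r x` of a strongly continuous family `F` of
contractions. -/
def strongIntegral (F : ℝ → H →L[ℂ] H) (hF : ∀ x, Continuous fun r => F r x)
    (hb : ∀ r x, ‖F r x‖ ≤ ‖x‖) (u v : ℝ) : H →L[ℂ] H :=
  LinearMap.mkContinuous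
    { toFun := fun x => ∫ r in u..v, F r x
      map_add' := fun x y => by
        simp only [map_add]
        exact intervalIntegral.integral_add ((hF x).intervalIntegrable _ _)
          ((hF y).intervalIntegrable _ _)
      map_smul' := fun c x => by
        simp only [map_smul, RingHom.id_apply]
        exact intervalIntegral.integral_smul c _ }
    |v - u| (fun x => by
      rw [mul_comm]
      exact intervalIntegral.norm_integral_le_of_norm_le_const fun r _ => hb r x)

section strongIntegral

variable {F : ℝ → H →L[ℂ] H} (hF : ∀ x, Continuous fun r => F r x)
  (hb : ∀ r x, ‖F r x‖ ≤ ‖x‖) (u v : ℝ)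

omit [CompleteSpace H] in
theorem strongIntegral_apply (x : H) :
    strongIntegral F hF hb u v x = ∫ r in u..v, F r x := rfl

omit [CompleteSpace H] in
theorem norm_strongIntegral_le : ‖strongIntegral F hF hb u v‖ ≤ |v - u| :=
  LinearMap.mkContinuous_norm_le _ (abs_nonneg _) _

theorem apply_strongIntegral (y : H →L[ℂ] H) (x : H) :
    y (strongIntegral F hF hb u v x) = ∫ r in u..v, y (F r x) :=
  (y.intervalIntegral_comp_comm ((hF x).intervalIntegrable _ _)).symm

theorem strongIntegral_mem {N : VonNeumannAlgebra H} (h : ∀ r, F r ∈ N) :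
    strongIntegral F hF hb u v ∈ N := by
  refine mem_of_forall_commutant fun y hy x => ?_
  rw [apply_strongIntegral, strongIntegral_apply]
  simp_rw [apply_comm_of_mem_commutant hy (h _)]

theorem inner_strongIntegral (x y : H) :
    ⟪x, strongIntegral F hF hb u v y⟫_ℂ = ∫ r in u..v, ⟪x, F r y⟫_ℂ :=
  ((innerSL ℂ x).intervalIntegral_comp_comm ((hF y).intervalIntegrable _ _)).symm

/-- For a family of projections, the integral is the form `x ↦ ∫ ‖F r x‖²`. -/
theorem inner_strongIntegral_self (hp : ∀ r, IsStarProjection (F r)) (x : H) :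
    ⟪x, strongIntegral F hF hb u v x⟫_ℂ = ((∫ r in u..v, ‖F r x‖ ^ 2 : ℝ) : ℂ) := by
  rw [inner_strongIntegral, ← intervalIntegral.integral_ofReal]
  refine intervalIntegral.integral_congr fun r _ => ?_
  rw [Complex.ofReal_pow]
  refine Eq.trans ?_ (inner_self_eq_norm_sq_to_K (𝕜 := ℂ) (F r x))
  rw [← ContinuousLinearMap.adjoint_inner_right, ← ContinuousLinearMap.star_eq_adjoint,
    (hp r).isSelfAdjoint.star_eq, isStarProjection_apply_self (hp r)]

theorem strongIntegral_nonneg (hp : ∀ r, IsStarProjection (F r)) {u v : ℝ} (huv : u ≤ v) :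
    0 ≤ strongIntegral F hF hb u v := by
  rw [ContinuousLinearMap.nonneg_iff_isPositive, ContinuousLinearMap.isPositive_iff_complex]
  intro x
  have h := inner_strongIntegral_self hF hb u v hp x
  rw [← inner_conj_symm, h, Complex.conj_ofReal]
  refine ⟨rfl, ?_⟩
  exact intervalIntegral.integral_nonneg huv fun r _ => sq_nonneg _

theorem strongIntegral_apply_eq_zero_iff (hp : ∀ r, IsStarProjection (F r)) {u v : ℝ}
    (huv : u < v) (x : H) :
    strongIntegral F hF hb u v x = 0 ↔ ∀ r ∈ Set.Icc u v, F r x = 0 := by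
  constructor
  · intro h r hr
    have h1 := inner_strongIntegral_self hF hb u v hp x
    rw [h, inner_zero_right] at h1
    have h2 : ∫ r in u..v, ‖F r x‖ ^ 2 = 0 := by exact_mod_cast h1.symm
    by_contra hne
    refine h2.not_gt (intervalIntegral.integral_pos huv ((hF x).norm.pow 2).continuousOn
      (fun r _ => sq_nonneg _) ⟨r, hr, ?_⟩)
    have := norm_pos_iff.2 hne
    positivity
  · intro h
    rw [strongIntegral_apply, intervalIntegral.integral_congr (g := fun _ => 0),
      intervalIntegral.integral_zero]
    intro r hr
    exact h r (by rwa [Set.uIcc_of_le huv.le] at hr)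

theorem strongIntegral_mul_strongIntegral_eq_zero {F' : ℝ → H →L[ℂ] H}
    (hF' : ∀ x, Continuous fun r => F' r x) (hb' : ∀ r x, ‖F' r x‖ ≤ ‖x‖) {u v u' v' : ℝ}
    (h : ∀ r ∈ Set.uIcc u v, ∀ r' ∈ Set.uIcc u' v', F r * F' r' = 0) :
    strongIntegral F hF hb u v * strongIntegral F' hF' hb' u' v' = 0 := by
  ext x
  rw [mul_apply_eq_comp, strongIntegral_apply, intervalIntegral.integral_congr (g := fun _ => 0),
    intervalIntegral.integral_zero]
  · rfl
  intro r hr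
  simp only
  rw [apply_strongIntegral, intervalIntegral.integral_congr (g := fun _ => 0),
    intervalIntegral.integral_zero]
  intro r' hr'
  exact congr($(h r hr r' hr') x)

end strongIntegral

/-- The function `t ↦ (t - l)₊` of `a` is the positive part of `a - l`. -/
theorem cfc_max_sub_eq_posPart {a : H →L[ℂ] H} (ha : IsSelfAdjoint a) (l : ℝ) :
    cfc (fun t : ℝ => max (t - l) 0) a = (a - algebraMap ℝ (H →L[ℂ] H) l)⁺ := by
  have h : a - algebraMap ℝ (H →L[ℂ] H) l = cfc (fun t : ℝ => t - l) a := by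
    rw [cfc_sub (fun t : ℝ => t) (fun _ => l) a, cfc_id' ℝ a, cfc_const l a]
  rw [CFC.posPart_def, cfcₙ_eq_cfc, h, ← cfc_comp' (fun t : ℝ => t⁺) (fun t : ℝ => t - l) a]
  rfl

/-- A diffuse decreasing resolution is recovered as the spectral resolution of its integral:
`∫ₛᵇ G` and `∫₀ˢ (1 - G)` are the positive and negative parts of `∫₀ᵇ G - s`. -/
theorem spectralProjIoi_strongIntegral {G : ℝ → H →L[ℂ] H} (hp : ∀ r, IsStarProjection (G r))
    (hG : Antitone G) (hc : ∀ x, Continuous fun r => G r x) (hb : ∀ r x, ‖G r x‖ ≤ ‖x‖)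
    {b s : ℝ} (hGb : G b = 0) (h0 : 0 ≤ s) (hs : s ≤ b) :
    spectralProjIoi (strongIntegral G hc hb 0 b) s = G s := by
  have hc' : ∀ x, Continuous fun r => (1 - G r) x := fun x => continuous_const.sub (hc x)
  have hb' : ∀ r x, ‖(1 - G r) x‖ ≤ ‖x‖ := fun r x =>
    isStarProjection_norm_apply_le (hp r).one_sub x
  have hsa : IsSelfAdjoint (strongIntegral G hc hb 0 b) :=
    .of_nonneg (strongIntegral_nonneg hc hb hp (h0.trans hs))
  have hdec : strongIntegral G hc hb 0 b - algebraMap ℝ (H →L[ℂ] H) s =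
      strongIntegral G hc hb s b - strongIntegral _ hc' hb' 0 s := by
    ext x
    have h1 := intervalIntegral.integral_add_adjacent_intervals
      ((hc x).intervalIntegrable (μ := MeasureTheory.volume) 0 s) ((hc x).intervalIntegrable s b)
    have h2 : ∫ r in (0 : ℝ)..s, (1 - G r) x = s • x - ∫ r in (0 : ℝ)..s, G r x := by
      simp only [sub_apply, one_apply_eq_self]
      rw [intervalIntegral.integral_sub (continuous_const.intervalIntegrable _ _)
        ((hc x).intervalIntegrable _ _), intervalIntegral.integral_const, sub_zero]
    rw [sub_apply, sub_apply, strongIntegral_apply, strongIntegral_apply, strongIntegral_apply,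
      h2, ← h1, Algebra.algebraMap_eq_smul_one, smul_apply, one_apply_eq_self]
    abel
  have hpos : cfc (fun t : ℝ => max (t - s) 0) (strongIntegral G hc hb 0 b) =
      strongIntegral G hc hb s b := by
    rw [cfc_max_sub_eq_posPart hsa]
    refine (CFC.posPart_negPart_unique hdec ?_ (strongIntegral_nonneg hc hb hp hs)
      (strongIntegral_nonneg hc' hb' (fun r => (hp r).one_sub) h0)).1
    refine strongIntegral_mul_strongIntegral_eq_zero _ _ _ _ fun r hr r' hr' => ?_
    rw [Set.uIcc_of_le hs] at hr
    rw [Set.uIcc_of_le h0] at hr'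
    rw [mul_sub, mul_one, ((hp r).le_iff_mul_eq_left (hp r')).1 (hG (hr'.2.trans hr.1)), sub_self]
  refine isStarProjection_eq_of_apply_eq_zero_iff (isStarProjection_spectralProjIoi _ _) (hp s)
    fun x => ?_
  rw [spectralProjIoi, rangeProj_apply_eq_zero_iff (cfc_predicate _ _), hpos]
  rcases hs.eq_or_lt with rfl | hs
  · simp [strongIntegral_apply, hGb]
  rw [strongIntegral_apply_eq_zero_iff hc hb hp hs]
  refine ⟨fun h => h s ⟨le_rfl, hs.le⟩, fun h r hr => ?_⟩
  rw [← isStarProjection_apply_apply_of_le' (hp r) (hp s) (hG hr.1), h, map_zero]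

theorem norm_strongIntegral_eq {G : ℝ → H →L[ℂ] H} (hp : ∀ r, IsStarProjection (G r))
    (hG : Antitone G) (hc : ∀ x, Continuous fun r => G r x) (hb : ∀ r x, ‖G r x‖ ≤ ‖x‖)
    {b : ℝ} (hb0 : 0 ≤ b) (hGb : G b = 0) (hne : ∀ s, s < b → G s ≠ 0) :
    ‖strongIntegral G hc hb 0 b‖ = b := by
  refine le_antisymm (by simpa [abs_of_nonneg hb0] using norm_strongIntegral_le hc hb 0 b) ?_
  by_contra! h
  refine hne _ h ?_
  rw [← spectralProjIoi_strongIntegral hp hG hc hb hGb (norm_nonneg _) h.le]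
  exact spectralProjIoi_eq_zero le_rfl

/-! ### The dimension function on the projections of a von Neumann algebra -/

/-- The projections of the von Neumann algebra `N`, with the order of operators. -/
abbrev Proj (N : VonNeumannAlgebra H) := {p : H →L[ℂ] H // p ∈ N ∧ IsStarProjection p}

namespace Proj

variable {M N : VonNeumannAlgebra H}

/-- The complementary projection `1 - p`. -/
def compl (p : Proj N) : Proj N := ⟨1 - p.1, sub_mem (one_mem N) p.2.1, p.2.2.one_sub⟩

theorem compl_le_compl {p q : Proj N} (h : p ≤ q) : q.compl ≤ p.compl :=
  Subtype.coe_le_coe.1 (sub_le_sub_left (Subtype.coe_le_coe.2 h) 1)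

theorem compl_compl (p : Proj N) : p.compl.compl = p := Subtype.ext (sub_sub_cancel 1 p.1)

theorem compl_le_compl_iff {p q : Proj N} : q.compl ≤ p.compl ↔ p ≤ q :=
  ⟨fun h => by simpa only [compl_compl] using compl_le_compl h, compl_le_compl⟩

/-- `p` is the supremum of the set `S` of projections, and a limit of elements of `S` for the
strong operator topology. -/
def IsStrongSup (S : Set (Proj N)) (p : Proj N) : Prop :=
  (∀ q ∈ S, q ≤ p) ∧ ∀ x : H, ∀ ε > 0, ∃ q ∈ S, ‖p.1 x - q.1 x‖ < ε

/-- The projection onto the closure of the union of the ranges is a strong supremum. -/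
theorem exists_isStrongSup {S : Set (Proj N)} (hS : S.Nonempty) (hd : DirectedOn (· ≤ ·) S) :
    ∃ p, IsStrongSup S p := by
  have : Nonempty S := hS.to_subtype
  let K : Submodule ℂ H := ⨆ q : S, q.1.1.range
  have hdir : Directed (· ≤ ·) fun q : S => (q.1.1.range : Submodule ℂ H) := by
    intro q q'
    obtain ⟨r, hr, hqr, hqr'⟩ := hd q.1 q.2 q'.1 q'.2
    refine ⟨⟨r, hr⟩, ?_, ?_⟩
    · rintro _ ⟨x, rfl⟩
      exact ⟨q.1.1 x, isStarProjection_apply_apply_of_le q.1.2.2 r.2.2 hqr x⟩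
    · rintro _ ⟨x, rfl⟩
      exact ⟨q'.1.1 x, isStarProjection_apply_apply_of_le q'.1.2.2 r.2.2 hqr' x⟩
  have hK : ∀ z, z ∈ K ↔ ∃ q ∈ S, q.1 z = z := by
    intro z
    rw [Submodule.mem_iSup_of_directed _ hdir]
    constructor
    · rintro ⟨q, x, rfl⟩
      exact ⟨q.1, q.2, isStarProjection_apply_self q.1.2.2 x⟩
    · rintro ⟨q, hq, hz⟩
      exact ⟨⟨q, hq⟩, z, hz⟩
  let p : Proj N := ⟨K.topologicalClosure.starProjection,
    starProjection_topologicalClosure_mem K fun y hy z hz => by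
      obtain ⟨q, hq, hqz⟩ := (hK z).1 hz
      exact (hK _).2 ⟨q, hq, by rw [← apply_comm_of_mem_commutant hy q.2.1, hqz]⟩,
    isStarProjection_starProjection⟩
  have hle : ∀ q ∈ S, q ≤ p := fun q hq => by
    refine q.2.2.le_of_mul_eq_right p.2.2 ?_
    ext x
    exact Submodule.starProjection_eq_self_iff.2 (Submodule.le_topologicalClosure _
      ((hK _).2 ⟨q, hq, isStarProjection_apply_self q.2.2 x⟩))
  refine ⟨p, hle, fun x ε hε => ?_⟩
  have hx : p.1 x ∈ K.topologicalClosure := Submodule.starProjection_apply_mem _ x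
  obtain ⟨z, hz, hxz⟩ := Metric.mem_closure_iff.1
    (show p.1 x ∈ closure (K : Set H) from hx) ε hε
  obtain ⟨q, hq, hqz⟩ := (hK z).1 hz
  refine ⟨q, hq, ?_⟩
  have e : p.1 x - q.1 x = (1 - q.1) (p.1 x - z) := by
    simp [hqz, isStarProjection_apply_apply_of_le' q.2.2 p.2.2 (hle q hq)]
  rw [e]
  exact (isStarProjection_norm_apply_le q.2.2.one_sub _).trans_lt (by rwa [← dist_eq_norm])

theorem IsStrongSup.le_of_forall_le {S : Set (Proj N)} {p : Proj N} (h : IsStrongSup S p)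
    {T : H →L[ℂ] H} (hT : ∀ q ∈ S, q.1 ≤ T) : p.1 ≤ T := by
  obtain ⟨q₀, hq₀, -⟩ := h.2 0 1 one_pos
  have hsa : IsSelfAdjoint (T - p.1) := by
    have h1 : IsSelfAdjoint (T - q₀.1) := .of_nonneg (sub_nonneg.2 (hT q₀ hq₀))
    have h2 := (h1.add q₀.2.2.isSelfAdjoint).sub p.2.2.isSelfAdjoint
    rwa [sub_add_cancel] at h2
  rw [ContinuousLinearMap.le_def, ContinuousLinearMap.isPositive_def']
  refine ⟨hsa, fun x => ?_⟩
  rw [ContinuousLinearMap.reApplyInnerSelf_apply]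
  refine le_of_forall_pos_le_add fun ε hε => ?_
  obtain ⟨q, hq, hx⟩ := h.2 x (ε / (‖x‖ + 1)) (by positivity)
  have h1 : 0 ≤ RCLike.re ⟪(T - q.1) x, x⟫_ℂ :=
    ((ContinuousLinearMap.le_def _ _).1 (hT q hq)).re_inner_nonneg_left x
  have h2 : (T - q.1) x = (T - p.1) x + (p.1 x - q.1 x) := by simp
  have h3 : RCLike.re ⟪p.1 x - q.1 x, x⟫_ℂ ≤ ε := by
    refine (RCLike.re_le_norm _).trans ((norm_inner_le_norm _ _).trans ?_)
    have h4 : ‖p.1 x - q.1 x‖ * (‖x‖ + 1) < ε := (lt_div_iff₀ (by positivity)).1 hx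
    nlinarith [norm_nonneg (p.1 x - q.1 x)]
  rw [h2, inner_add_left, map_add] at h1
  linarith

theorem IsStrongSup.isLUB {S : Set (Proj N)} {p : Proj N} (h : IsStrongSup S p) : IsLUB S p :=
  ⟨h.1, fun _ hr => Subtype.coe_le_coe.1 (h.le_of_forall_le fun _ hq => hr hq)⟩

/-- The trace of a projection of a subalgebra `N` of `M`, as a real number. The trace stays on `M`,
so that normality is only ever used for suprema in `M`. -/
def dim (hNM : N ≤ M) (τ : M.toStarSubalgebra →ₗ[ℂ] ℂ) (p : Proj N) : ℝ :=
  (τ ⟨p.1, hNM p.2.1⟩).re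

theorem star_mul_self_eq (hNM : N ≤ M) (p : Proj N) :
    star (⟨p.1, hNM p.2.1⟩ : M.toStarSubalgebra) * ⟨p.1, hNM p.2.1⟩ = ⟨p.1, hNM p.2.1⟩ :=
  Subtype.ext (by
    change star p.1 * p.1 = p.1
    rw [p.2.2.isSelfAdjoint.star_eq, p.2.2.isIdempotentElem.eq])

section dim

variable {τ : M.toStarSubalgebra →ₗ[ℂ] ℂ} (hτ : IsFaithfulNormalTrace M τ) (hNM : N ≤ M)

include hτ in
theorem dim_nonneg (p : Proj N) : 0 ≤ dim hNM τ p := by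
  have h := hτ.nonneg ⟨p.1, hNM p.2.1⟩
  rw [star_mul_self_eq] at h
  exact (Complex.le_def.1 h).1

include hτ in
theorem eq_zero_of_dim_eq_zero {p : Proj N} (h0 : dim hNM τ p = 0) : p.1 = 0 := by
  have h := hτ.nonneg ⟨p.1, hNM p.2.1⟩
  have h' := hτ.faithful ⟨p.1, hNM p.2.1⟩
  rw [star_mul_self_eq] at h h'
  exact congrArg Subtype.val (h' (Complex.ext h0 (Complex.le_def.1 h).2.symm))

/-- The projection `q - p`, for `p ≤ q`. -/
def diff {p q : Proj N} (h : p ≤ q) : Proj N :=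
  ⟨q.1 - p.1, sub_mem q.2.1 p.2.1, (p.2.2.le_iff_sub q.2.2).1 h⟩

theorem dim_diff {p q : Proj N} (h : p ≤ q) :
    dim hNM τ (diff h) = dim hNM τ q - dim hNM τ p := by
  rw [dim, dim, dim, ← Complex.sub_re, ← map_sub]
  rfl

include hτ in
theorem dim_mono {p q : Proj N} (h : p ≤ q) : dim hNM τ p ≤ dim hNM τ q := by
  have := dim_nonneg hτ hNM (diff h)
  rw [dim_diff] at this
  linarith

include hτ in
theorem eq_of_le_of_dim_le {p q : Proj N} (h : p ≤ q) (hd : dim hNM τ q ≤ dim hNM τ p) :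
    p = q := by
  have h1 : dim hNM τ (diff h) = 0 := by
    rw [dim_diff]
    linarith [dim_mono hτ hNM h]
  exact Subtype.ext (sub_eq_zero.1 (eq_zero_of_dim_eq_zero hτ hNM h1)).symm

include hτ in
theorem le_of_dim_le_of_isChain {C : Set (Proj N)} (hC : IsChain (· ≤ ·) C) {p q : Proj N}
    (hp : p ∈ C) (hq : q ∈ C) (h : dim hNM τ p ≤ dim hNM τ q) : p ≤ q :=
  (hC.total hp hq).elim id fun h' => (eq_of_le_of_dim_le hτ hNM h' h).ge

include hτ in
theorem dim_compl (p : Proj N) : dim hNM τ p.compl = 1 - dim hNM τ p := by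
  have h : (⟨p.compl.1, hNM p.compl.2.1⟩ : M.toStarSubalgebra) = 1 - ⟨p.1, hNM p.2.1⟩ := rfl
  rw [dim, dim, h, map_sub, hτ.map_one, Complex.sub_re, Complex.one_re]

include hτ in
theorem dim_le_one (p : Proj N) : dim hNM τ p ≤ 1 := by
  have := dim_nonneg hτ hNM p.compl
  rw [dim_compl hτ] at this
  linarith

theorem dim_eq_zero {p : Proj N} (h : p.1 = 0) : dim hNM τ p = 0 := by
  have : (⟨p.1, hNM p.2.1⟩ : M.toStarSubalgebra) = 0 := Subtype.ext h
  rw [dim, this, map_zero, Complex.zero_re]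

include hτ in
theorem dim_eq_one {p : Proj N} (h : p.1 = 1) : dim hNM τ p = 1 := by
  have : (⟨p.1, hNM p.2.1⟩ : M.toStarSubalgebra) = 1 := Subtype.ext h
  rw [dim, this, hτ.map_one, Complex.one_re]

include hτ in
theorem dim_pos {p : Proj N} (h : p.1 ≠ 0) : 0 < dim hNM τ p :=
  (dim_nonneg hτ hNM p).lt_of_ne fun h0 => h (eq_zero_of_dim_eq_zero hτ hNM h0.symm)

include hτ in
theorem eq_one_of_dim_eq_one {p : Proj N} (h : dim hNM τ p = 1) : p.1 = 1 := by
  have h1 : dim hNM τ p.compl = 0 := by rw [dim_compl hτ, h, sub_self]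
  exact (sub_eq_zero.1 (eq_zero_of_dim_eq_zero hτ hNM h1)).symm

include hτ in
/-- Normality of the trace, on directed sets of projections. -/
theorem IsStrongSup.isLUB_dim {S : Set (Proj N)} {p : Proj N} (h : IsStrongSup S p)
    (hd : DirectedOn (· ≤ ·) S) : IsLUB (dim hNM τ '' S) (dim hNM τ p) := by
  obtain ⟨q₀, hq₀, -⟩ := h.2 0 1 one_pos
  let ι : Proj N → M.toStarSubalgebra := fun q => ⟨q.1, hNM q.2.1⟩
  have h1 := hτ.normal (ι '' S) (ι p) ⟨_, q₀, hq₀, rfl⟩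
    (by rintro _ ⟨q, -, rfl⟩; exact q.2.2.nonneg)
    (by
      rintro _ ⟨q, hq, rfl⟩ _ ⟨q', hq', rfl⟩
      obtain ⟨r, hr, h1, h2⟩ := hd q hq q' hq'
      exact ⟨ι r, ⟨r, hr, rfl⟩, h1, h2⟩)
    ⟨by rintro _ ⟨q, hq, rfl⟩; exact h.1 q hq,
      fun T hT => h.le_of_forall_le (T := T.1) fun q hq => hT ⟨q, hq, rfl⟩⟩
  rwa [Set.image_image] at h1

end dim

end Proj

/-! ### Chains of projections parametrized by dimension -/

namespace Proj

variable {M N : VonNeumannAlgebra H} {τ : M.toStarSubalgebra →ₗ[ℂ] ℂ}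

/-- A decreasing family of projections whose dimension is continuous is right-continuous for the
strong operator topology. -/
theorem continuousWithinAt_Ici_apply (hτ : IsFaithfulNormalTrace M τ) (hNM : N ≤ M)
    {G : ℝ → Proj N} (hG : Antitone G) (hd : Continuous fun s => dim hNM τ (G s)) (x : H) (t : ℝ) :
    ContinuousWithinAt (fun s => (G s).1 x) (Set.Ici t) t := by
  have hdir : DirectedOn (· ≤ ·) (G '' Set.Ioi t) := by
    rintro _ ⟨r, hr, rfl⟩ _ ⟨s, hs, rfl⟩
    exact ⟨_, ⟨min r s, Set.mem_Ioi.2 (lt_min hr hs), rfl⟩, hG (min_le_left _ _),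
      hG (min_le_right _ _)⟩
  obtain ⟨p, hp⟩ := exists_isStrongSup (Set.nonempty_Ioi.image G) hdir
  have hpt : p ≤ G t := hp.isLUB.2 (by rintro _ ⟨s, hs, rfl⟩; exact hG (le_of_lt hs))
  obtain rfl : p = G t := by
    refine eq_of_le_of_dim_le hτ hNM hpt ?_
    refine le_of_tendsto (hd.continuousWithinAt (s := Set.Ioi t) (x := t)) ?_
    filter_upwards [self_mem_nhdsWithin] with s hs
    exact dim_mono hτ hNM (hp.1 _ ⟨s, hs, rfl⟩)
  refine Metric.tendsto_nhds.2 fun ε hε => ?_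
  obtain ⟨_, ⟨m, hm, rfl⟩, hmx⟩ := hp.2 x ε hε
  filter_upwards [self_mem_nhdsWithin, mem_nhdsWithin_of_mem_nhds (Iio_mem_nhds hm)] with s hs hs'
  rw [dist_eq_norm, norm_sub_rev]
  exact (norm_sub_apply_le_of_le_of_le (G m).2.2 (G s).2.2 (G t).2.2
    (hG (le_of_lt hs')) (hG hs) x).trans_lt hmx

theorem continuous_apply (hτ : IsFaithfulNormalTrace M τ) (hNM : N ≤ M)
    {G : ℝ → Proj N} (hG : Antitone G) (hd : Continuous fun s => dim hNM τ (G s)) (x : H) :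
    Continuous fun s => (G s).1 x := by
  refine continuous_iff_continuousAt.2 fun t => ?_
  refine continuousAt_iff_continuous_left_right.2
    ⟨?_, continuousWithinAt_Ici_apply hτ hNM hG hd x t⟩
  -- left continuity is right continuity of the complementary family `s ↦ 1 - G (-s)`
  have h := continuousWithinAt_Ici_apply hτ hNM (G := fun s => (G (-s)).compl)
    (fun r s hrs => compl_le_compl (hG (neg_le_neg hrs)))
    (by simp only [dim_compl hτ]; exact continuous_const.sub (hd.comp continuous_neg)) x (-t)
  have h1 : ContinuousWithinAt (fun s => x - (G (- -s)).compl.1 x) (Set.Iic t) t := by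
    refine continuousWithinAt_const.sub (ContinuousWithinAt.comp (t := Set.Ici (-t))
      (f := fun s : ℝ => -s) h continuous_neg.continuousWithinAt fun s hs => ?_)
    exact neg_le_neg (show s ≤ t from hs)
  simpa [compl] using h1

/-- If `N` has no minimal projections, its projections are densely ordered. -/
theorem exists_between (hmin : ∀ p, ¬ IsMinimalProjection N p) {p q : Proj N} (h : p < q) :
    ∃ m, p < m ∧ m < q := by
  have h1 := hmin (diff h.le).1
  simp only [IsMinimalProjection, not_and, not_forall, not_or] at h1
  obtain ⟨r, hrN, hr, hrd, hr0, hrd'⟩ := h1 (diff h.le).2.1 (diff h.le).2.2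
    (fun h0 => h.ne' (Subtype.ext (sub_eq_zero.1 h0)))
  have hpq := (p.2.2.le_iff_mul_eq_left q.2.2).1 h.le
  have hpr : p.1 * r = 0 := by
    rw [← (hr.le_iff_mul_eq_right (diff h.le).2.2).1 hrd, ← mul_assoc]
    simp [diff, mul_sub, hpq, p.2.2.isIdempotentElem.eq]
  let m : Proj N := ⟨p.1 + r, add_mem p.2.1 hrN, p.2.2.add hr hpr⟩
  refine ⟨m, lt_of_le_of_ne ?_ ?_, lt_of_le_of_ne ?_ ?_⟩
  · exact Subtype.coe_le_coe.1 (le_add_of_nonneg_right hr.nonneg)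
  · intro he
    exact hr0 (left_eq_add.1 (congrArg Subtype.val he))
  · exact Subtype.coe_le_coe.1 (le_sub_iff_add_le'.1 hrd)
  · intro he
    exact hrd' (eq_sub_of_add_eq' (congrArg Subtype.val he))

/-- Along a maximal chain of projections the dimension takes every value in `[0, 1]`: the chain is
closed under suprema and infima, and it has no gaps. -/
theorem exists_mem_maxChain_dim_eq (hτ : IsFaithfulNormalTrace M τ) (hNM : N ≤ M)
    (hmin : ∀ p, ¬ IsMinimalProjection N p) {C : Set (Proj N)} (hC : IsMaxChain (· ≤ ·) C)
    {s : ℝ} (h0 : 0 ≤ s) (h1 : s ≤ 1) : ∃ p ∈ C, dim hNM τ p = s := by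
  have hmem : ∀ r : Proj N, (∀ c ∈ C, r ≤ c ∨ c ≤ r) → r ∈ C := fun r hr => by
    have := hC.2 (hC.1.insert fun c hc _ => hr c hc) (Set.subset_insert r C)
    rw [this]
    exact Set.mem_insert r C
  obtain ⟨p, hp⟩ := exists_isStrongSup (S := {c ∈ C | dim hNM τ c ≤ s})
    ⟨⟨0, zero_mem N, .zero _⟩, hmem _ fun c _ => .inl (Subtype.coe_le_coe.1 c.2.2.nonneg),
      (dim_eq_zero hNM rfl).trans_le h0⟩
    (hC.1.mono fun c hc => hc.1).directedOn
  have hps : dim hNM τ p ≤ s := by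
    refine (hp.isLUB_dim hτ hNM (hC.1.mono fun c hc => hc.1).directedOn).2 ?_
    rintro _ ⟨c, hc, rfl⟩
    exact hc.2
  -- infima are taken as complements of suprema of complements
  have hdir : DirectedOn (· ≤ ·) (compl '' {c ∈ C | s ≤ dim hNM τ c}) := by
    rintro _ ⟨c, hc, rfl⟩ _ ⟨c', hc', rfl⟩
    rcases hC.1.total hc.1 hc'.1 with h | h
    · exact ⟨_, ⟨c, hc, rfl⟩, le_rfl, compl_le_compl h⟩
    · exact ⟨_, ⟨c', hc', rfl⟩, compl_le_compl h, le_rfl⟩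
  obtain ⟨q', hq'⟩ := exists_isStrongSup (S := compl '' {c ∈ C | s ≤ dim hNM τ c})
    ⟨_, ⟨1, one_mem N, .one _⟩, ⟨hmem _ fun c _ => .inr (Subtype.coe_le_coe.1 c.2.2.le_one),
      h1.trans_eq (dim_eq_one hτ hNM rfl).symm⟩, rfl⟩ hdir
  obtain ⟨q, rfl⟩ : ∃ q : Proj N, q.compl = q' := ⟨q'.compl, q'.compl_compl⟩
  have hqs : s ≤ dim hNM τ q := by
    have : dim hNM τ q.compl ≤ 1 - s := by
      refine (hq'.isLUB_dim hτ hNM hdir).2 ?_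
      rintro _ ⟨_, ⟨c, hc, rfl⟩, rfl⟩
      rw [dim_compl hτ]
      linarith [hc.2]
    rw [dim_compl hτ] at this
    linarith
  have hlow : ∀ c ∈ C, dim hNM τ c ≤ s → c ≤ p := fun c hc h => hp.1 c ⟨hc, h⟩
  have hupp : ∀ c ∈ C, s ≤ dim hNM τ c → q ≤ c := fun c hc h =>
    compl_le_compl_iff.1 (hq'.1 _ ⟨c, ⟨hc, h⟩, rfl⟩)
  have hpq : p ≤ q := by
    refine hp.isLUB.2 fun c hc => compl_le_compl_iff.1 (hq'.isLUB.2 ?_)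
    rintro _ ⟨c', hc', rfl⟩
    exact compl_le_compl
      (le_of_dim_le_of_isChain hτ hNM hC.1 hc.1 hc'.1 (hc.2.trans hc'.2))
  -- everything between `p` and `q` is comparable with the chain, hence belongs to it
  have hbetween : ∀ m, p ≤ m → m ≤ q → m ∈ C := fun m hpm hmq => hmem m fun c hc =>
    (le_total (dim hNM τ c) s).elim (fun h => .inr ((hlow c hc h).trans hpm))
      fun h => .inl (hmq.trans (hupp c hc h))
  rcases hpq.eq_or_lt with rfl | hlt
  · exact ⟨p, hbetween p le_rfl le_rfl, le_antisymm hps hqs⟩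
  · obtain ⟨m, hpm, hmq⟩ := exists_between hmin hlt
    have hmC := hbetween m hpm.le hmq.le
    rcases le_total (dim hNM τ m) s with h | h
    · exact absurd (hlow m hmC h) hpm.not_ge
    · exact absurd (hupp m hmC h) hmq.not_ge

/-- Every decreasing family of projections is part of a chain of projections parametrized by
dimension. -/
theorem exists_monotone_dim_eq (hτ : IsFaithfulNormalTrace M τ) (hNM : N ≤ M)
    (hmin : ∀ p, ¬ IsMinimalProjection N p) {E : ℝ → Proj N} (hE : Antitone E) :
    ∃ e : Set.Icc (0 : ℝ) 1 → Proj N, Monotone e ∧ (∀ s, dim hNM τ (e s) = s) ∧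
      ∀ l (s : Set.Icc (0 : ℝ) 1), dim hNM τ (E l) = s → e s = E l := by
  have hch : IsChain (· ≤ ·) (Set.range E) := by
    rintro _ ⟨l, rfl⟩ _ ⟨m, rfl⟩ -
    exact (le_total l m).elim (fun h => .inr (hE h)) fun h => .inl (hE h)
  obtain ⟨C, hC, hEC⟩ := hch.exists_maxChain
  choose e heC hes using fun s : Set.Icc (0 : ℝ) 1 =>
    exists_mem_maxChain_dim_eq hτ hNM hmin hC s.2.1 s.2.2
  refine ⟨e, fun s t hst => le_of_dim_le_of_isChain hτ hNM hC.1 (heC s) (heC t) ?_, hes,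
    fun l s hls => le_antisymm (le_of_dim_le_of_isChain hτ hNM hC.1 (heC s) (hEC ⟨l, rfl⟩) ?_)
      (le_of_dim_le_of_isChain hτ hNM hC.1 (hEC ⟨l, rfl⟩) (heC s) ?_)⟩
  · rw [hes, hes]; exact hst
  · rw [hes, hls]
  · rw [hes, hls]

end Proj

/-! ### Masas -/

/-- A masa contains every element of `M` commuting with it. -/
theorem IsMasa.mem_of_commute {M : VonNeumannAlgebra H} {A : StarSubalgebra ℂ (H →L[ℂ] H)}
    (hA : IsMasa M A) {x : H →L[ℂ] H} (hx : x ∈ M) (h : ∀ y ∈ A, x * y = y * x) : x ∈ A := by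
  -- adjoining a self-adjoint element keeps the algebra abelian
  have hsa : ∀ z ∈ M, IsSelfAdjoint z → (∀ y ∈ A, z * y = y * z) → z ∈ A := by
    intro z hzM hz hzA
    have hcomm : ∀ u ∈ insert z (A : Set (H →L[ℂ] H)), ∀ v ∈ insert z (A : Set (H →L[ℂ] H)),
        u * v = v * u := by
      rintro u (rfl | hu) v (rfl | hv)
      · rfl
      · exact hzA v hv
      · exact (hzA u hu).symm
      · exact hA.prop.2 u hu v hv
    have hstar : ∀ v ∈ insert z (A : Set (H →L[ℂ] H)),
        star v ∈ insert z (A : Set (H →L[ℂ] H)) := by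
      rintro v (rfl | hv)
      · exact .inl hz.star_eq
      · exact .inr (star_mem hv)
    have := StarAlgebra.isMulCommutative_adjoin ℂ hcomm fun u hu v hv => hcomm u hu _ (hstar v hv)
    have hle := hA.le_of_ge (y := StarAlgebra.adjoin ℂ (insert z (A : Set (H →L[ℂ] H))))
      ⟨StarAlgebra.adjoin_le (Set.insert_subset hzM hA.prop.1),
        fun u hu v hv => setLike_mul_comm hu hv⟩
      fun v hv => StarAlgebra.subset_adjoin _ _ (.inr hv)
    exact hle (StarAlgebra.subset_adjoin _ _ (.inl rfl))
  have hs : ∀ y ∈ A, star x * y = y * star x := fun y hy => by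
    simpa using congrArg star (h (star y) (star_mem hy)).symm
  have h1 : x + star x ∈ A := hsa _ (add_mem hx (star_mem hx)) (.add_star_self x)
    fun y hy => by rw [add_mul, mul_add, h y hy, hs y hy]
  have h2 : Complex.I • (x - star x) ∈ A := by
    refine hsa _ (M.toStarSubalgebra.smul_mem (sub_mem hx (star_mem hx)) _) ?_ fun y hy => by
      rw [smul_mul_assoc, mul_smul_comm, sub_mul, mul_sub, h y hy, hs y hy]
    simp [IsSelfAdjoint, star_smul, ← smul_neg]
  have h3 : x = (1 / 2 : ℂ) • ((x + star x) - Complex.I • (Complex.I • (x - star x))) := by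
    rw [smul_smul, Complex.I_mul_I]
    module
  rw [h3]
  exact A.smul_mem (sub_mem h1 (A.smul_mem h2 _)) _

/-- A masa is a von Neumann algebra. -/
theorem IsMasa.exists_vonNeumannAlgebra {M : VonNeumannAlgebra H}
    {A : StarSubalgebra ℂ (H →L[ℂ] H)} (hA : IsMasa M A) :
    ∃ N : VonNeumannAlgebra H, N.toStarSubalgebra = A := by
  refine ⟨⟨A, le_antisymm (fun x hx => ?_) Set.subset_centralizer_centralizer⟩, rfl⟩
  refine hA.mem_of_commute ?_ fun y hy => (hx y fun z hz => hA.prop.2 z hz y hy).symm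
  have : x ∈ Set.centralizer (Set.centralizer (M : Set (H →L[ℂ] H))) :=
    Set.centralizer_subset (Set.centralizer_subset hA.prop.1) hx
  rwa [VonNeumannAlgebra.centralizer_centralizer] at this

theorem posPart_mem {N : VonNeumannAlgebra H} {a : H →L[ℂ] H} (ha : IsSelfAdjoint a)
    (haN : a ∈ N) : a⁺ ∈ N := by
  rw [CFC.posPart_def, cfcₙ_eq_cfc]
  exact cfc_mem ha haN _

/-- In an abelian von Neumann algebra, a minimal projection `p` is a joint eigenprojection. Let `c`
be the value of `x` at a vector state `v` below `p`, and `y = (x - c) p`. By minimality the range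
projection of `y⁺` is `0` or `p`, so `y⁺` or `y⁻` kills `v`; as the form of `y` vanishes at `v`,
both do. Hence the range projection of `y` is not `p`, so it is `0`. -/
theorem IsMinimalProjection.exists_mul_eq_smul {N : VonNeumannAlgebra H}
    (hN : ∀ x ∈ N, ∀ y ∈ N, x * y = y * x) {p : H →L[ℂ] H} (hp : IsMinimalProjection N p)
    {x : H →L[ℂ] H} (hxN : x ∈ N) (hx : IsSelfAdjoint x) : ∃ c : ℝ, x * p = c • p := by
  obtain ⟨hpN, hpp, hp0, hmin⟩ := hp
  obtain ⟨v, hv, hpv⟩ : ∃ v, v ≠ 0 ∧ p v = v := by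
    by_contra! h
    refine hp0 (ContinuousLinearMap.ext fun w => ?_)
    by_contra hw
    exact h (p w) hw (isStarProjection_apply_self hpp w)
  set c : ℝ := (⟪x v, v⟫_ℂ).re / ‖v‖ ^ 2 with hc
  set y : H →L[ℂ] H := x * p - c • p with hy
  have hpx := hN p hpN x hxN
  have hyN : y ∈ N := sub_mem (mul_mem hxN hpN) (N.toStarSubalgebra.smul_mem hpN (c : ℂ))
  have hysa : IsSelfAdjoint y := by
    refine .sub ?_ (.smul (by simp [IsSelfAdjoint]) hpp.isSelfAdjoint)
    rw [IsSelfAdjoint, star_mul, hx.star_eq, hpp.isSelfAdjoint.star_eq, hpx]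
  have hyp : ∀ w, p w = 0 → y w = 0 := fun w hw => by simp [hy, hw]
  have hposN : y⁺ ∈ N := posPart_mem hysa hyN
  have hnegN : y⁻ ∈ N := by
    rw [← CFC.posPart_neg]; exact posPart_mem hysa.neg (neg_mem hyN)
  have hpos0 : 0 ≤ y⁺ := CFC.posPart_nonneg y
  have hneg0 : 0 ≤ y⁻ := CFC.negPart_nonneg y
  have hdec : y⁺ - y⁻ = y := CFC.posPart_sub_negPart y
  have hyv : ⟪y v, v⟫_ℂ = 0 := by
    have h1 : ((⟪x v, v⟫_ℂ).re : ℂ) = ⟪x v, v⟫_ℂ := by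
      refine Complex.conj_eq_iff_re.1 ?_
      rw [inner_conj_symm, ← ContinuousLinearMap.adjoint_inner_left,
        ← ContinuousLinearMap.star_eq_adjoint, hx.star_eq]
    have h2 : (‖v‖ : ℂ) ≠ 0 := by exact_mod_cast norm_ne_zero_iff.2 hv
    have h3 : y v = x v - (c : ℂ) • v := by
      simp [hy, hpv]
    rw [h3, inner_sub_left, inner_smul_left, inner_self_eq_norm_sq_to_K, hc, ← h1]
    simp [h2]
  have hrange : ∀ z ∈ N, IsSelfAdjoint z → (∀ w, y w = 0 → z w = 0) →
      rangeProj z = 0 ∨ rangeProj z = p := fun z hzN hz hzy =>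
    hmin _ (rangeProj_mem hzN) (isStarProjection_rangeProj z)
      (isStarProjection_le_of_apply_eq_zero (isStarProjection_rangeProj z) hpp fun w hw =>
        (rangeProj_apply_eq_zero_iff hz w).2 (hzy w (hyp w hw)))
  have hposy : ∀ w, y w = 0 → y⁺ w = 0 := by
    intro w hw
    have h1 : y⁺ * y⁺ = y⁺ * y := by
      have h2 : y⁺ * (y⁺ - y⁻) = y⁺ * y := congrArg (y⁺ * ·) hdec
      rwa [mul_sub, CFC.posPart_mul_negPart, sub_zero] at h2
    have h2 : y⁺ (y⁺ w) = 0 := by simpa [hw] using congr($h1 w)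
    rw [← inner_self_eq_zero (𝕜 := ℂ), ← ContinuousLinearMap.adjoint_inner_left,
      ← ContinuousLinearMap.star_eq_adjoint, (IsSelfAdjoint.of_nonneg hpos0).star_eq, h2,
      inner_zero_left]
  -- one of `y⁺`, `y⁻` kills `v`, and hence so does the other one
  have hyv' : ⟪y⁺ v, v⟫_ℂ = ⟪y⁻ v, v⟫_ℂ := by
    rw [← sub_eq_zero, ← inner_sub_left, ← hyv]
    exact congrArg (fun u => ⟪u, v⟫_ℂ) congr($hdec v)
  have hyv0 : y v = 0 := by
    suffices y⁺ v = 0 ∧ y⁻ v = 0 by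
      rw [← hdec, sub_apply, this.1, this.2, sub_zero]
    rcases hrange _ hposN (.of_nonneg hpos0) hposy with h | h
    · have h1 : y⁺ v = 0 := by
        rw [(rangeProj_eq_zero_iff (.of_nonneg hpos0)).1 h]; rfl
      rw [h1, inner_zero_left] at hyv'
      exact ⟨h1, eq_zero_of_inner_self_eq_zero hneg0 hyv'.symm⟩
    · have h1 : y⁻ v = 0 := by
        have h2 : y⁻ (p v) = p (y⁻ v) := congr($(hN _ hnegN _ hpN) v)
        rw [← hpv, h2, ← h, rangeProj_apply_eq_zero_iff (.of_nonneg hpos0)]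
        exact congr($(CFC.posPart_mul_negPart y) v)
      rw [h1, inner_zero_left] at hyv'
      exact ⟨eq_zero_of_inner_self_eq_zero hpos0 hyv', h1⟩
  refine ⟨c, sub_eq_zero.1 ((rangeProj_eq_zero_iff hysa).1
    ((hrange y hyN hysa fun _ => id).resolve_right fun h => hv ?_))⟩
  rw [← hpv, ← h, rangeProj_apply_eq_zero_iff hysa, hyv0]

/-- A minimal projection of a masa is minimal in the ambient algebra. -/
theorem IsMasa.isMinimalProjection {M N : VonNeumannAlgebra H}
    (hN : IsMasa M N.toStarSubalgebra) {p : H →L[ℂ] H} (hp : IsMinimalProjection N p) :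
    IsMinimalProjection M p := by
  have hNM : ∀ x ∈ N, x ∈ M := fun x hx => hN.prop.1 hx
  refine ⟨hNM p hp.1, hp.2.1, hp.2.2.1, fun q hqM hq hqp => hp.2.2.2 q ?_ hq hqp⟩
  have h1 : q * p = q := (hq.le_iff_mul_eq_left hp.2.1).1 hqp
  have h2 : p * q = q := (hq.le_iff_mul_eq_right hp.2.1).1 hqp
  have hsa : ∀ x ∈ N, IsSelfAdjoint x → q * x = x * q := by
    intro x hx hxsa
    obtain ⟨c, hc⟩ := hp.exists_mul_eq_smul hN.prop.2 hx hxsa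
    have hc' : p * x = c • p := (hN.prop.2 p hp.1 x hx).trans hc
    calc q * x = q * p * x := by rw [h1]
      _ = c • q := by rw [mul_assoc, hc', mul_smul_comm, h1]
      _ = x * p * q := by rw [hc, smul_mul_assoc, h2]
      _ = x * q := by rw [mul_assoc, h2]
  refine hN.mem_of_commute hqM fun x hx => ?_
  have hx' : star x ∈ N := star_mem hx
  have e1 := hsa _ (add_mem hx hx') (.add_star_self x)
  have e2 := hsa (Complex.I • (x - star x))
    (N.toStarSubalgebra.smul_mem (sub_mem hx hx') _)
    (by simp [IsSelfAdjoint, star_smul, ← smul_neg])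
  rw [mul_smul_comm, smul_mul_assoc] at e2
  have e3 := smul_right_injective _ Complex.I_ne_zero e2
  have e4 : x = (1 / 2 : ℂ) • ((x + star x) + (x - star x)) := by module
  rw [e4, mul_smul_comm, smul_mul_assoc, mul_add, add_mul _ _ q, e1, e3]

/-! ### The refined resolution -/

/-- The graph of a decreasing function `d`, completed by vertical segments at the jumps, is the
graph of a `1`-Lipschitz decreasing function of the coordinate `s = l + 1 - d l`. The smallest
nonnegative such function is used: at `s` it is the supremum of `min (d l) (l + 1 - s)` over `l`,
cut off below at `0`. -/
theorem exists_continuous_antitone_reparam {d : ℝ → ℝ} (hd : Antitone d) (hd0 : ∀ l, 0 ≤ d l)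
    (hd1 : ∀ l, d l ≤ 1) {b : ℝ} (hneg : ∀ l < 0, d l = 1)
    (hpos : ∀ l < b, 0 < d l) :
    ∃ φ : ℝ → ℝ, Continuous φ ∧ Antitone φ ∧ (∀ s, φ s ∈ Set.Icc (0 : ℝ) 1) ∧
      (∀ l, φ (l + 1 - d l) = d l) ∧ φ 0 = 1 ∧ ∀ s < b + 1, 0 < φ s := by
  have hbdd : ∀ s, BddAbove (Set.range fun l => max 0 (min (d l) (l + 1 - s))) := fun s => by
    refine ⟨1, ?_⟩
    rintro _ ⟨l, rfl⟩
    exact max_le zero_le_one ((min_le_left _ _).trans (hd1 l))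
  set φ : ℝ → ℝ := fun s => ⨆ l, max 0 (min (d l) (l + 1 - s)) with hφ
  have hle : ∀ l s, min (d l) (l + 1 - s) ≤ φ s := fun l s =>
    (le_max_right _ _).trans (le_ciSup (hbdd s) l)
  have hφ1 : ∀ s, φ s ≤ 1 := fun s =>
    ciSup_le fun l => max_le zero_le_one ((min_le_left _ _).trans (hd1 l))
  have hφ0 : ∀ s, 0 ≤ φ s := fun s => (le_max_left _ _).trans (le_ciSup (hbdd s) 0)
  have hanti : Antitone φ := fun s t hst => ciSup_mono (hbdd s) fun l =>
    max_le_max le_rfl (min_le_min le_rfl (by linarith))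
  have hlip : ∀ s t, φ s ≤ φ t + dist s t := by
    intro s t
    refine ciSup_le fun l => max_le (add_nonneg (hφ0 t) dist_nonneg) ?_
    have h1 := hle l t
    have h2 : t - s ≤ dist s t := by
      rw [Real.dist_eq, abs_sub_comm]; exact le_abs_self _
    rcases min_cases (d l) (l + 1 - t) with ⟨h, -⟩ | ⟨h, -⟩
    · linarith [min_le_left (d l) (l + 1 - s), dist_nonneg (x := s) (y := t)]
    · linarith [min_le_right (d l) (l + 1 - s)]
  refine ⟨φ, (LipschitzWith.of_le_add hlip).continuous, hanti, fun s => ⟨hφ0 s, hφ1 s⟩,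
    fun l => le_antisymm ?_ ?_, le_antisymm (hφ1 0) ?_, fun s hs => ?_⟩
  · refine ciSup_le fun m => max_le (hd0 l) ?_
    rcases le_total l m with h | h
    · exact (min_le_left _ _).trans (hd h)
    · exact (min_le_right _ _).trans (by linarith)
  · refine le_trans (le_of_eq ?_) (hle l _)
    rw [eq_comm, min_eq_left]
    linarith
  · refine le_of_forall_pos_le_add fun ε hε => ?_
    have h1 := hle (-ε) 0
    rw [hneg _ (by linarith), min_eq_right (by linarith)] at h1
    linarith
  · obtain ⟨l, hl, hlb⟩ := exists_between (show s - 1 < b by linarith)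
    exact (lt_min (hpos l hlb) (by linarith)).trans_le (hle l s)

/-- The spectral projection of `a` for `(l, ∞)`, as a projection of `N`. -/
def spectralProj {N : VonNeumannAlgebra H} {a : H →L[ℂ] H} (ha : IsSelfAdjoint a) (haN : a ∈ N)
    (l : ℝ) : Proj N :=
  ⟨spectralProjIoi a l, spectralProjIoi_mem ha haN l, isStarProjection_spectralProjIoi a l⟩

theorem continuousWithinAt_dim_spectralProj {M N : VonNeumannAlgebra H}
    {τ : M.toStarSubalgebra →ₗ[ℂ] ℂ} (hτ : IsFaithfulNormalTrace M τ) (hNM : N ≤ M)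
    {a : H →L[ℂ] H} (ha : IsSelfAdjoint a) (haN : a ∈ N) (t : ℝ) :
    ContinuousWithinAt (fun l => Proj.dim hNM τ (spectralProj ha haN l)) (Set.Ici t) t := by
  have hanti : Antitone (spectralProj ha haN) := antitone_spectralProjIoi a
  have hsup : Proj.IsStrongSup (spectralProj ha haN '' Set.Ioi t) (spectralProj ha haN t) := by
    refine ⟨by rintro _ ⟨m, hm, rfl⟩; exact hanti (le_of_lt hm), fun x ε hε => ?_⟩
    obtain ⟨m, hm, hmx⟩ := exists_norm_spectralProjIoi_sub_lt a t x hε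
    exact ⟨_, ⟨m, hm, rfl⟩, hmx⟩
  have hlub := hsup.isLUB_dim hτ hNM (by
    rintro _ ⟨r, hr, rfl⟩ _ ⟨s, hs, rfl⟩
    exact ⟨_, ⟨min r s, Set.mem_Ioi.2 (lt_min hr hs), rfl⟩, hanti (min_le_left _ _),
      hanti (min_le_right _ _)⟩)
  refine Metric.tendsto_nhds.2 fun ε hε => ?_
  obtain ⟨_, ⟨_, ⟨m, hm, rfl⟩, rfl⟩, hlt, -⟩ := hlub.exists_between (sub_lt_self _ hε)
  filter_upwards [self_mem_nhdsWithin, mem_nhdsWithin_of_mem_nhds (Iio_mem_nhds hm)] with s hs hs'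
  have h1 := Proj.dim_mono hτ hNM (hanti (show t ≤ s from hs))
  have h2 := Proj.dim_mono hτ hNM (hanti (le_of_lt hs'))
  rw [Real.dist_eq, abs_sub_lt_iff]
  constructor <;> linarith

/-- The refinement, inside a von Neumann subalgebra `N` of `M` without minimal projections. The
resolution `G` runs through a chain of projections parametrized by dimension, and reaches the
spectral projection `E l` of `a` at `l + 1 - d l`; then `a' = ∫ G`. -/
theorem exists_continuousDistribution_stronglyRefines {M N : VonNeumannAlgebra H}
    {τ : M.toStarSubalgebra →ₗ[ℂ] ℂ} (hτ : IsFaithfulNormalTrace M τ) (hNM : N ≤ M)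
    (hmin : ∀ p, ¬ IsMinimalProjection N p) {a : H →L[ℂ] H} (haN : a ∈ N) (ha : 0 ≤ a) :
    ∃ a' ∈ N, 0 ≤ a' ∧ HasContinuousDistribution M a' ∧ InducedStronglyRefines M a' a := by
  have : Nontrivial H := by
    by_contra h
    rw [not_nontrivial_iff_subsingleton] at h
    have h1 : (1 : M.toStarSubalgebra) = 0 := Subtype.ext (Subsingleton.elim _ _)
    have h2 := hτ.map_one
    rw [h1, map_zero] at h2
    exact zero_ne_one h2
  have hsa : IsSelfAdjoint a := .of_nonneg ha
  set E : ℝ → Proj N := spectralProj hsa haN with hE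
  have hEanti : Antitone E := antitone_spectralProjIoi a
  set d : ℝ → ℝ := fun l => Proj.dim hNM τ (E l) with hd
  have hdanti : Antitone d := fun l m h => Proj.dim_mono hτ hNM (hEanti h)
  have hd0 : ∀ l, 0 ≤ d l := fun l => Proj.dim_nonneg hτ hNM _
  have hd1 : ∀ l, d l ≤ 1 := fun l => Proj.dim_le_one hτ hNM _
  have hdb : d ‖a‖ = 0 := Proj.dim_eq_zero hNM (spectralProjIoi_eq_zero le_rfl)
  obtain ⟨φ, hφc, hφanti, hφ, hφd, hφ0, hφpos⟩ := exists_continuous_antitone_reparam hdanti hd0 hd1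
    (fun l hl => Proj.dim_eq_one hτ hNM (spectralProjIoi_eq_one ha hl))
    (fun l hl => Proj.dim_pos hτ hNM (spectralProjIoi_ne_zero ha hl))
  obtain ⟨e, hemono, hedim, heE⟩ := Proj.exists_monotone_dim_eq hτ hNM hmin hEanti
  set G : ℝ → Proj N := fun s => e ⟨φ s, hφ s⟩ with hG
  have hGdim : ∀ s, Proj.dim hNM τ (G s) = φ s := fun s => hedim _
  have hGanti : Antitone G := fun s t hst => hemono (hφanti hst)
  have hGE : ∀ l, G (l + 1 - d l) = E l := fun l => heE l _ (hφd l).symm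
  have hGc : ∀ x, Continuous fun s => (G s).1 x :=
    Proj.continuous_apply hτ hNM hGanti (by simpa only [hGdim] using hφc)
  have hGp : ∀ s, IsStarProjection (G s).1 := fun s => (G s).2.2
  have hGb : (G (‖a‖ + 1)).1 = 0 := by
    have := hGE ‖a‖
    rw [hdb, sub_zero] at this
    rw [this]
    exact spectralProjIoi_eq_zero le_rfl
  have hG0 : (G 0).1 = 1 := Proj.eq_one_of_dim_eq_one hτ hNM ((hGdim 0).trans hφ0)
  have hGne : ∀ s < ‖a‖ + 1, (G s).1 ≠ 0 := fun s hs h0 =>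
    (hφpos s hs).ne' ((hGdim s).symm.trans (Proj.dim_eq_zero hNM h0))
  have hGn : ∀ s x, ‖(G s).1 x‖ ≤ ‖x‖ := fun s x => isStarProjection_norm_apply_le (hGp s) x
  have hb : 0 ≤ ‖a‖ + 1 := by positivity
  set a' : H →L[ℂ] H := strongIntegral (fun s => (G s).1) hGc hGn 0 (‖a‖ + 1) with ha'
  have ha'N : a' ∈ N := strongIntegral_mem _ _ _ _ fun s => (G s).2.1
  have ha'0 : 0 ≤ a' := strongIntegral_nonneg _ _ hGp hb
  have hnorm : ‖a'‖ = ‖a‖ + 1 := norm_strongIntegral_eq hGp hGanti hGc hGn hb hGb hGne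
  have hspec : ∀ s ∈ Set.Icc 0 ‖a'‖, spectralProjIoi a' s = (G s).1 := fun s hs =>
    spectralProjIoi_strongIntegral hGp hGanti hGc hGn hGb hs.1 (hs.2.trans_eq hnorm)
  have hbrsr' : IsBRSR M 0 ‖a'‖ (spectralProjIoi a') :=
    isBRSR_spectralProjIoi (.of_nonneg ha'0) (hNM ha'N)
  refine ⟨a', ha'N, ha'0, ⟨hbrsr', ?_⟩, fun l => l + 1 - d l, ⟨isBRSR_spectralProjIoi hsa (hNM haN),
    hbrsr', ?_, ?_, ?_, ?_, ?_⟩, ?_, ?_⟩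
  · refine Set.eq_empty_iff_forall_notMem.2 ?_
    rintro t (⟨ht, h⟩ | ⟨rfl, h⟩)
    · exact h fun x => (hGc x).continuousWithinAt.congr
        (fun s hs => by rw [hspec s hs]) (by rw [hspec t (Set.Ioc_subset_Icc_self ht)])
    · exact h (by rw [hspec 0 ⟨le_rfl, norm_nonneg _⟩, hG0])
  · intro l hl
    rw [hnorm]
    exact ⟨by linarith [hl.1, hd1 l], by linarith [hl.2, hd0 l]⟩
  · intro l _ m _ h
    linarith [hdanti h]
  · intro t _
    exact ((continuousWithinAt_id.add continuousWithinAt_const).sub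
      (continuousWithinAt_dim_spectralProj hτ hNM hsa haN t)).mono Set.Icc_subset_Ici_self
  · simp only [hdb, hnorm, sub_zero]
  · intro t ht
    rw [hspec]
    · rw [hGE]; rfl
    · rw [hnorm]
      exact ⟨by linarith [ht.1, hd1 t], by linarith [ht.2, hd0 t]⟩
  · intro t _
    linarith [hd1 t]
  · intro s _ t _ h
    linarith [hdanti h.le]

end SpectralRefinement

end

theorem theorem3p2 {H : Type*} [NormedAddCommGroup H] [InnerProductSpace ℂ H] [CompleteSpace H]
    (M : VonNeumannAlgebra H) (τ : M.toStarSubalgebra →ₗ[ℂ] ℂ)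
    (hM : SpectralRefinement.IsIIOneFactor M τ)
    (a : H →L[ℂ] H) (haM : a ∈ M) (ha : 0 ≤ a) :
    (∃ a' : H →L[ℂ] H, a' ∈ M ∧ 0 ≤ a' ∧
      SpectralRefinement.HasContinuousDistribution M a' ∧
      SpectralRefinement.InducedStronglyRefines M a' a) ∧
    (∀ A : StarSubalgebra ℂ (H →L[ℂ] H), SpectralRefinement.IsMasa M A → a ∈ A →
      ∃ a' : H →L[ℂ] H, a' ∈ A ∧ 0 ≤ a' ∧
        SpectralRefinement.HasContinuousDistribution M a' ∧
        SpectralRefinement.InducedStronglyRefines M a' a) := by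
  refine ⟨SpectralRefinement.exists_continuousDistribution_stronglyRefines hM.trace le_rfl
    hM.no_minimal haM ha, fun A hA haA => ?_⟩
  obtain ⟨N, rfl⟩ := hA.exists_vonNeumannAlgebra
  exact SpectralRefinement.exists_continuousDistribution_stronglyRefines hM.trace hA.prop.1
    (fun p hp => hM.no_minimal p (hA.isMinimalProjection hp)) haA ha
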